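/- Let $d,d_x,n\ge 0$ and $k,L\ge 1$ be integers, and let $\tau_l,\tau_g,b_l,b_g>0$, step sizes $\eta_1,\dots,\eta_k>0$, a positive-definite matrix $M\in\mathbb R^{d\times d}$ and $\theta_0\in\mathbb R^d$ be given. Let $p(x\mid\theta)>0$ ($x\in\mathbb R^{d_x}$, $\theta\in\mathbb R^d$) be a likelihood and $p(\theta)>0$ a prior such that $\ln p(x\mid\cdot)$, for every $x$, and $\ln p(\cdot)$ are differentiable on $\mathbb R^d$. Write $\mathrm{clip}_b(y)=y\min\{b/\|y\|_2,1\}$ (with $\mathrm{clip}_b(0)=0$) and $x\in X$ for the rows of a dataset $X\in\mathbb R^{n\times d_x}$, and put $$c_l(\theta,\theta')=b_l\|\theta-\theta'\|_2,\quad \sigma_l^2(\theta,\theta')=4\tau_l^2c_l^2(\theta,\theta'),\quad \sigma_g^2=4b_g^2\tau_g^2,\quad g(\theta)=\varsigma\Big(\sum_{x\in X}\mathrm{clip}_{b_g}(\nabla_\theta\ln p(x\mid\theta))+\nabla\ln p(\theta)\Big),$$ where $\varsigma\in\{-1,1\}$ is a fixed sign ($\varsigma=-1$ being the gradient of the potential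 $-\ln p$). The algorithm DP-HMC on input $X$ performs the following for $i=1,\dots,k$, all sampling being independent of the past. Put $\theta=\theta_{i-1}$ and sample $p\sim\mathcal N_d(0,M)$. Starting from $(\theta',p')=(\theta,p)$, apply the noisy leapfrog simulation with $L$ steps: the momentum update $l_{p_{\eta_i/2}}$; then $L-1$ times the position update $l_\theta$ followed by $l_{p_{\eta_i}}$; then $l_\theta$ and finally $l_{p_{\eta_i/2}}$. Here $l_\theta(\theta',p')=(\theta'+\eta_iM^{-1}p',p')$ and $l_{p_s}(\theta',p')=(\theta',p'-s(g(\theta')+\xi))$ with a fresh $\xi\sim\mathcal N_d(0,\sigma_g^2I)$ at every momentum update. Then let $$\Delta H=\sum_{x\in X}\mathrm{clip}_{c_l(\theta,\theta')}\Big(\ln\frac{p(x\mid\theta')}{p(x\mid\theta)}\Big)+\tfrac12p^TM^{-1}p-\tfrac12p'^TM^{-1}p'+\ln\frac{p(\theta')}{p(\theta)}+\xi,$$ with $\xi\sim\mathcal N(0,\sigma_l^2(\theta,\theta'))$, sample $u\sim\mathrm{Unif}(0,1)$, and put $\theta_i=\theta'$ if $\ln u<\Delta H-\frac12\sigma_l^2(\theta,\theta')$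 and $\theta_i=\theta$ otherwise. The output is $(\theta_1,\dots,\theta_k)$. **Theorem.** For every $\varepsilon\in\mathbb R$, DP-HMC is $(\varepsilon,\delta(\varepsilon))$-ADP under the substitute neighbourhood relation; that is, its output law is a well-defined probability measure on $(\mathbb R^d)^k$ for every dataset, and for all $X,X'\in\mathbb R^{n\times d_x}$ that differ in at most one row and all measurable $S\subset(\mathbb R^d)^k$, $$P(\text{DP-HMC}(X)\in S)\le e^{\varepsilon}P(\text{DP-HMC}(X')\in S)+\delta(\varepsilon),$$ where $$\delta(\varepsilon)=\frac12\left(\mathrm{erfc}\Big(\frac{\varepsilon-\mu}{2\sqrt\mu}\Big)-e^{\varepsilon}\,\mathrm{erfc}\Big(\frac{\varepsilon+\mu}{2\sqrt\mu}\Big)\right),\qquad \mu=\frac{k}{2\tau_l^2}+\frac{k(L+1)}{2\tau_g^2},$$ and $\mathrm{erfc}(x)=\frac{2}{\sqrt\pi}\int_x^\infty e^{-t^2}\,dt$. -/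

import Mathlib

open MeasureTheory ProbabilityTheory Matrix

noncomputable section

namespace DPHMC

/-- The parameter space `ℝᵈ` with its Euclidean norm. -/
abbrev Vec (d : ℕ) : Type := EuclideanSpace ℝ (Fin d)

/-- A dataset in `ℝ^{n × dₓ}`; the rows `X i` are the data points. -/
abbrev Dataset (n dx : ℕ) : Type := Matrix (Fin n) (Fin dx) ℝ

/-! ### Differential privacy -/

/-- Substitute neighbourhood: the two datasets differ in at most one row. -/
def SubstNeighbour {n dx : ℕ} (X X' : Dataset n dx) : Prop :=
  {i | X i ≠ X' i}.encard ≤ 1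

/-- `(ε, δ)`-ADP of a mechanism, given by the law `Mech X` of its output on each input `X`.
That each `Mech X` is a probability law is part of being a mechanism. -/
def IsADP {α Ω : Type*} [MeasurableSpace Ω] (nbr : α → α → Prop) (Mech : α → Measure Ω)
    (ε δ : ℝ) : Prop :=
  (∀ X, IsProbabilityMeasure (Mech X)) ∧
    ∀ X X', nbr X X' → ∀ S : Set Ω, MeasurableSet S →
      (Mech X).real S ≤ Real.exp ε * (Mech X').real S + δ

/-- The complementary error function. -/
def erfc (x : ℝ) : ℝ := 2 / √Real.pi * ∫ t in Set.Ioi x, Real.exp (-t ^ 2)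

/-- The privacy profile `δ(ε)` with parameter `μ`. -/
def gaussDelta (μ ε : ℝ) : ℝ :=
  1 / 2 * (erfc ((ε - μ) / (2 * √μ)) - Real.exp ε * erfc ((ε + μ) / (2 * √μ)))

/-- `clip_b(y) = y min {b / ‖y‖, 1}`. -/
def clip {E : Type*} [NormedAddCommGroup E] [NormedSpace ℝ E] (b : ℝ) (y : E) : E :=
  min (b / ‖y‖) 1 • y

/-! ### The algorithm

The law of each randomised step is written as a measure depending on the current state, and
`Measure.bind` is sequential composition ("sample, then continue with the sampled value"). -/

/-- The inputs of the algorithm other than the data, the number of iterations and the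
step sizes. -/
structure Input (d dx : ℕ) where
  /-- the likelihood `p(x ∣ θ)`, as a function of `x` and `θ` -/
  lik : (Fin dx → ℝ) → Vec d → ℝ
  /-- the prior `p(θ)` -/
  prior : Vec d → ℝ
  /-- noise parameter for the log-likelihood ratios -/
  τl : ℝ
  /-- noise parameter for the gradients -/
  τg : ℝ
  /-- clip bound for the log-likelihood ratios -/
  bl : ℝ
  /-- clip bound for the gradients -/
  bg : ℝ
  /-- number of leapfrog steps -/
  L : ℕ
  /-- mass matrix -/
  M : Matrix (Fin d) (Fin d) ℝ
  /-- initial value -/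
  θ₀ : Vec d
  /-- sign convention for the gradient in the momentum update:
  `-1` for the gradient of the potential `-ln p`, `1` for the gradient of `ln p` -/
  sgn : ℤˣ

variable {d dx n : ℕ}

namespace Input

/-- `σ_g² = 4 b_g² τ_g²`. -/
def gradVar (A : Input d dx) : ℝ := 4 * A.bg ^ 2 * A.τg ^ 2

/-- `c_l(θ, θ') = b_l ‖θ - θ'‖`. -/
def ratioClip (A : Input d dx) (θ θ' : Vec d) : ℝ := A.bl * ‖θ - θ'‖

/-- `σ_l²(θ, θ') = 4 τ_l² c_l(θ, θ')²`. -/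
def ratioVar (A : Input d dx) (θ θ' : Vec d) : ℝ := 4 * A.τl ^ 2 * A.ratioClip θ θ' ^ 2

/-- `g(θ) = ± (∑_{x ∈ X} clip_{b_g}(∇ ln p(x ∣ θ)) + ∇ ln p(θ))`. -/
def clippedGrad (A : Input d dx) (X : Dataset n dx) (θ : Vec d) : Vec d :=
  (A.sgn : ℤ) • (∑ i, clip A.bg (gradient (fun t => Real.log (A.lik (X i) t)) θ)
    + gradient (fun t => Real.log (A.prior t)) θ)

/-- `M⁻¹ p`. -/
def velocity (A : Input d dx) (p : Vec d) : Vec d := WithLp.toLp 2 (A.M⁻¹ *ᵥ p.ofLp)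

/-- `½ pᵀ M⁻¹ p`. -/
def kinetic (A : Input d dx) (p : Vec d) : ℝ := 1 / 2 * (p.ofLp ⬝ᵥ (A.M⁻¹ *ᵥ p.ofLp))

/-- The noisy momentum update `l_{p_s}(θ, p) = (θ, p - s (g(θ) + ξ))` with a fresh
`ξ ∼ N_d(0, σ_g² I)`. -/
def momentumStep (A : Input d dx) (X : Dataset n dx) (s : ℝ) (z : Vec d × Vec d) :
    Measure (Vec d × Vec d) :=
  (multivariateGaussian 0 (A.gradVar • (1 : Matrix (Fin d) (Fin d) ℝ))).map
    fun ξ => (z.1, z.2 - s • (A.clippedGrad X z.1 + ξ))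

/-- The position update `l_θ(θ, p) = (θ + η M⁻¹ p, p)`. -/
def positionStep (A : Input d dx) (η : ℝ) (z : Vec d × Vec d) : Vec d × Vec d :=
  (z.1 + η • A.velocity z.2, z.2)

/-- `m` repetitions of: position update, then full momentum update. -/
def leapfrogLoop (A : Input d dx) (X : Dataset n dx) (η : ℝ) :
    ℕ → Vec d × Vec d → Measure (Vec d × Vec d)
  | 0, z => Measure.dirac z
  | m + 1, z => (A.leapfrogLoop X η m z).bind fun z' =>
      A.momentumStep X η (A.positionStep η z')

/-- The noisy and clipped leapfrog simulation. -/
def leapfrog (A : Input d dx) (X : Dataset n dx) (η : ℝ) (z : Vec d × Vec d) :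
    Measure (Vec d × Vec d) :=
  (A.momentumStep X (η / 2) z).bind fun z₁ =>
    (A.leapfrogLoop X η (A.L - 1) z₁).bind fun z₂ =>
      A.momentumStep X (η / 2) (A.positionStep η z₂)

/-- `R = ∑_{x ∈ X} clip_{c_l(θ, θ')}(ln (p(x ∣ θ') / p(x ∣ θ)))`. -/
def clippedRatio (A : Input d dx) (X : Dataset n dx) (θ θ' : Vec d) : ℝ :=
  ∑ i, clip (A.ratioClip θ θ') (Real.log (A.lik (X i) θ' / A.lik (X i) θ))

/-- `ΔH` for the noise value `ξ`. -/
def deltaH (A : Input d dx) (X : Dataset n dx) (z z' : Vec d × Vec d) (ξ : ℝ) : ℝ :=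
  A.clippedRatio X z.1 z'.1 + (A.kinetic z.2 - A.kinetic z'.2)
    + Real.log (A.prior z'.1 / A.prior z.1) + ξ

open Classical in
/-- The noisy acceptance test: sample `ξ ∼ N(0, σ_l²(θ, θ'))` and `u ∼ Unif(0, 1)`, and accept
when `ln u < ΔH - ½ σ_l²(θ, θ')`. -/
def acceptStep (A : Input d dx) (X : Dataset n dx) (z z' : Vec d × Vec d) : Measure (Vec d) :=
  (gaussianReal 0 (A.ratioVar z.1 z'.1).toNNReal).bind fun ξ =>
    (volume.restrict (Set.Ioo (0 : ℝ) 1)).map fun u =>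
      if Real.log u < A.deltaH X z z' ξ - 1 / 2 * A.ratioVar z.1 z'.1 then z'.1 else z.1

/-- One iteration of the outer loop with step size `η`: the law of `θ_i` given `θ_{i-1} = θ`. -/
def iteration (A : Input d dx) (X : Dataset n dx) (η : ℝ) (θ : Vec d) : Measure (Vec d) :=
  (multivariateGaussian 0 A.M).bind fun p =>
    (A.leapfrog X η (θ, p)).bind fun z' => A.acceptStep X (θ, p) z'

/-- The joint law of the next `k` iterates, started at `θ`. -/
def chain (A : Input d dx) (X : Dataset n dx) :
    (k : ℕ) → (Fin k → ℝ) → Vec d → Measure (Fin k → Vec d)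
  | 0, _, _ => Measure.dirac Fin.elim0
  | k + 1, η, θ => (A.iteration X (η 0) θ).bind fun θ₁ =>
      (A.chain X k (fun i => η i.succ) θ₁).map fun w => vecCons θ₁ w

/-- DP-HMC: the law of the released sequence `(θ₁, …, θ_k)` on input data `X`. -/
def dpHMC (A : Input d dx) {k : ℕ} (η : Fin k → ℝ) (X : Dataset n dx) :
    Measure (Fin k → Vec d) :=
  A.chain X k η A.θ₀

end Input

end DPHMC

end

/-!
Write `δ_μ(ε) = E (1 - e^{ε - Y})₊` with `Y ∼ N(μ, 2μ)` (`gaussProfile`). This is the trade-off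
between two Gaussian laws of the same covariance, whose log-likelihood ratio has law `N(μ, 2μ)`
under the first of them, and it equals `gaussDelta μ ε` (`toReal_gaussProfile`). Since
`N(μ, 2μ) ∗ N(ν, 2ν) = N(μ + ν, 2(μ + ν))`, integrating `δ_ν(ε - y)` against `N(μ, 2μ)` gives
`δ_{μ+ν}(ε)`.

Adaptive composition rests on this identity. Let a first step have the Gaussian laws `P` and `Q`,
with log-likelihood ratio `Λ`, and suppose that the probabilities `F z`, `G z` of an event when
the mechanism goes on from the state `z` satisfy `F z ≤ e^ε G z + δ_ν(ε)` for all `ε`. Applying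
this with `ε - Λ z` in place of `ε` and integrating against `P` gives
`∫ F dP ≤ e^ε ∫ G dQ + δ_{μ+ν}(ε)`, because `e^{-Λ} dP = dQ`. This property of a pair `(P, Q)`,
for all `ν`, `F` and `G`, is `GaussDominated μ P Q`. It holds for Gaussian laws
(`GaussDominated.gaussianReal`), is preserved by maps and products, and is additive in `μ` under
adaptive composition (`GaussDominated.bind`); with an indicator for `F = G` it yields the privacy
bound (`GaussDominated.measureReal_le`).

In DP-HMC the data enter through Gaussian mechanisms only. By clipping, the gradient has
sensitivity `2 b_g`, so each of the `L + 1` momentum updates of an iteration costs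
`(2 b_g)² / (2 σ_g²) = 1 / (2 τ_g²)`; the log-likelihood ratio has sensitivity `2 c_l`, so the
acceptance test costs `(2 c_l)² / (2 σ_l²) = 1 / (2 τ_l²)`. All other steps are common to both
datasets and cost nothing. Adding up over `k` iterations gives the parameter `μ`.
-/

/-! ### The Gaussian privacy profile -/

open scoped ENNReal NNReal

namespace DPHMC

/-- `E (1 - e^{ε - Y})₊` for `Y ∼ N(μ, 2μ)`, the law of the log-likelihood ratio of two
Gaussians with the same covariance. The positive part comes from the truncation in
`ENNReal.ofReal`. For `μ > 0` this is `gaussDelta μ ε`, see `toReal_gaussProfile`. -/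
noncomputable def gaussProfile (μ : ℝ≥0) (ε : ℝ) : ℝ≥0∞ :=
  ∫⁻ y, ENNReal.ofReal (1 - Real.exp (ε - y)) ∂gaussianReal μ (2 * μ)

lemma gaussProfile_zero (ε : ℝ) : gaussProfile 0 ε = ENNReal.ofReal (1 - Real.exp ε) := by
  simp [gaussProfile, gaussianReal_zero_var]

/-- Privacy profiles compose by convolution: log-likelihood ratios of successive steps add up. -/
lemma lintegral_gaussProfile_sub (μ ν : ℝ≥0) (ε : ℝ) :
    ∫⁻ x, gaussProfile ν (ε - x) ∂gaussianReal μ (2 * μ) = gaussProfile (μ + ν) ε := by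
  have h : gaussianReal ((μ + ν : ℝ≥0) : ℝ) (2 * (μ + ν))
      = (gaussianReal μ (2 * μ)) ∗ (gaussianReal ν (2 * ν)) := by
    rw [gaussianReal_conv_gaussianReal, mul_add, NNReal.coe_add]
  unfold gaussProfile
  rw [h, Measure.lintegral_conv (by fun_prop)]
  simp only [sub_sub]

lemma lintegral_exp_neg_gaussianReal (ν : ℝ≥0) :
    ∫⁻ y, ENNReal.ofReal (Real.exp (-y)) ∂gaussianReal ν (2 * ν) = 1 := by
  have h := mgf_gaussianReal (p := gaussianReal ν (2 * ν)) (X := id) (μ := ν) (v := 2 * ν)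
    (by simp) (-1)
  have hi : Integrable (fun y : ℝ => Real.exp (-y)) (gaussianReal ν (2 * ν)) := by
    simpa using integrable_exp_mul_gaussianReal (μ := (ν : ℝ)) (v := 2 * ν) (-1)
  rw [← ofReal_integral_eq_lintegral_ofReal hi (ae_of_all _ fun y => (Real.exp_pos _).le)]
  simp only [mgf, id, neg_mul, one_mul] at h
  rw [h, ← ENNReal.ofReal_one, NNReal.coe_mul, NNReal.coe_ofNat]
  congr 1
  rw [Real.exp_eq_one_iff]
  ring

/-- Conditional Jensen: adding an independent log-likelihood ratio increases the profile. -/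
lemma gaussProfile_le_add (μ ν : ℝ≥0) (ε : ℝ) : gaussProfile μ ε ≤ gaussProfile (μ + ν) ε := by
  rw [← lintegral_gaussProfile_sub, gaussProfile]
  refine lintegral_mono fun x => ?_
  rw [gaussProfile, ENNReal.ofReal_sub _ (Real.exp_pos _).le, tsub_le_iff_right]
  calc ENNReal.ofReal 1 = ∫⁻ _, 1 ∂gaussianReal ν (2 * ν) := by simp
    _ ≤ ∫⁻ y, (ENNReal.ofReal (1 - Real.exp (ε - x - y))
          + ENNReal.ofReal (Real.exp (ε - x)) * ENNReal.ofReal (Real.exp (-y)))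
          ∂gaussianReal ν (2 * ν) := by
        refine lintegral_mono fun y => ?_
        rw [← ENNReal.ofReal_mul (Real.exp_pos _).le, ← Real.exp_add, ← sub_eq_add_neg,
          ← ENNReal.ofReal_one]
        refine le_trans (ENNReal.ofReal_le_ofReal ?_) ENNReal.ofReal_add_le
        linarith
    _ = _ := by
        rw [lintegral_add_left (by fun_prop), lintegral_const_mul _ (by fun_prop),
          lintegral_exp_neg_gaussianReal, mul_one]

lemma gaussProfile_mono {μ ν : ℝ≥0} (h : μ ≤ ν) (ε : ℝ) :
    gaussProfile μ ε ≤ gaussProfile ν ε := by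
  obtain ⟨c, rfl⟩ := exists_add_of_le h
  exact gaussProfile_le_add μ c ε

lemma gaussianReal_Ioi_eq_erfc {m : ℝ} {μ : ℝ≥0} (hμ : 0 < μ) (ε : ℝ) :
    (gaussianReal m (2 * μ)).real (Set.Ioi ε) = 1 / 2 * erfc ((ε - m) / (2 * √μ)) := by
  have hμ' : (0 : ℝ) < μ := hμ
  have hs : 0 < 2 * √(μ : ℝ) := by positivity
  have hv : (2 * μ : ℝ≥0) ≠ 0 := by positivity
  have hsq : (2 * √(μ : ℝ)) ^ 2 = 4 * μ := by rw [mul_pow, Real.sq_sqrt hμ'.le]; norm_num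
  rw [measureReal_def, gaussianReal_apply_eq_integral _ hv, ENNReal.toReal_ofReal
    (integral_nonneg fun x => gaussianPDFReal_nonneg _ _ _), erfc]
  have h1 := integral_comp_mul_left_Ioi (fun t => Real.exp (-t ^ 2)) ((ε - m)) (inv_pos.2 hs)
  have h2 : ∫ x in Set.Ioi ε, gaussianPDFReal m (2 * μ) x
      = (√(2 * Real.pi * (2 * μ)))⁻¹ *
        ∫ x in Set.Ioi (ε - m), Real.exp (-((2 * √(μ : ℝ))⁻¹ * x) ^ 2) := by
    rw [← integral_const_mul]
    have := (measurePreserving_sub_right volume m).setIntegral_preimage_emb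
      (MeasurableEquiv.subRight m).measurableEmbedding
      (fun x => (√(2 * Real.pi * (2 * μ)))⁻¹ * Real.exp (-((2 * √(μ : ℝ))⁻¹ * x) ^ 2))
      (Set.Ioi (ε - m))
    rw [← this]
    have hpre : (fun x : ℝ => x - m) ⁻¹' Set.Ioi (ε - m) = Set.Ioi ε := by ext; simp
    rw [hpre]
    refine integral_congr_ae (ae_of_all _ fun x => ?_)
    simp only [gaussianPDFReal, NNReal.coe_mul, NNReal.coe_ofNat]
    congr 2
    rw [mul_pow, inv_pow, hsq]
    field_simp
    ring
  rw [h2, h1, inv_inv, inv_mul_eq_div, smul_eq_mul]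
  have : √(2 * Real.pi * (2 * (μ : ℝ))) = √Real.pi * (2 * √μ) := by
    rw [show 2 * Real.pi * (2 * (μ : ℝ)) = Real.pi * (2 * √μ) ^ 2 by rw [hsq]; ring,
      Real.sqrt_mul Real.pi_pos.le, Real.sqrt_sq hs.le]
  rw [this]
  have : √Real.pi ≠ 0 := by positivity
  field_simp

/-- Exponential tilting by `e^{-y}` moves the mean of `N(μ, 2μ)` from `μ` to `-μ`. -/
lemma exp_neg_mul_gaussianPDFReal {μ : ℝ≥0} (hμ : 0 < μ) (y : ℝ) :
    Real.exp (-y) * gaussianPDFReal μ (2 * μ) y = gaussianPDFReal (-μ) (2 * μ) y := by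
  have hμ' : (0 : ℝ) < μ := hμ
  simp only [gaussianPDFReal, NNReal.coe_mul, NNReal.coe_ofNat]
  rw [mul_left_comm, ← Real.exp_add]
  congr 2
  field_simp
  ring

lemma toReal_gaussProfile {μ : ℝ≥0} (hμ : 0 < μ) (ε : ℝ) :
    (gaussProfile μ ε).toReal = gaussDelta μ ε := by
  have hv : (2 * μ : ℝ≥0) ≠ 0 := by positivity
  have hpos : ∀ y : ℝ, ENNReal.ofReal (1 - Real.exp (ε - y))
      = ENNReal.ofReal ((Set.Ioi ε).indicator (fun y => 1 - Real.exp (ε - y)) y) := by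
    intro y
    by_cases hy : ε < y
    · rw [Set.indicator_of_mem (by exact hy)]
    · rw [Set.indicator_of_notMem (by simpa using hy), ENNReal.ofReal_zero,
        ENNReal.ofReal_eq_zero]
      have := Real.add_one_le_exp (ε - y)
      linarith [not_lt.1 hy]
  have hnn : ∀ y : ℝ, 0 ≤ (Set.Ioi ε).indicator (fun y => 1 - Real.exp (ε - y)) y := by
    refine fun y => Set.indicator_nonneg (fun y hy => ?_) y
    have : Real.exp (ε - y) ≤ 1 := Real.exp_le_one_iff.2 (by linarith [Set.mem_Ioi.1 hy])
    linarith
  have hm : Measurable fun y : ℝ => (Set.Ioi ε).indicator (fun y => 1 - Real.exp (ε - y)) y :=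
    (by fun_prop : Measurable fun y : ℝ => 1 - Real.exp (ε - y)).indicator measurableSet_Ioi
  rw [gaussProfile]
  simp_rw [hpos]
  rw [← integral_eq_lintegral_of_nonneg_ae (ae_of_all _ hnn) hm.aestronglyMeasurable,
    integral_gaussianReal_eq_integral_smul hv]
  have hpdf : ∀ y : ℝ, gaussianPDFReal μ (2 * μ) y •
        (Set.Ioi ε).indicator (fun y => 1 - Real.exp (ε - y)) y
      = (Set.Ioi ε).indicator (fun y => gaussianPDFReal μ (2 * μ) y
          - Real.exp ε * gaussianPDFReal (-μ) (2 * μ) y) y := by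
    intro y
    by_cases hy : y ∈ Set.Ioi ε
    · simp only [Set.indicator_of_mem hy, smul_eq_mul]
      rw [← exp_neg_mul_gaussianPDFReal hμ, sub_eq_add_neg ε, Real.exp_add]
      ring
    · simp [Set.indicator_of_notMem hy]
  simp_rw [hpdf]
  rw [integral_indicator measurableSet_Ioi, integral_sub
    (integrable_gaussianPDFReal _ _).integrableOn
    ((integrable_gaussianPDFReal _ _).const_mul _).integrableOn, integral_const_mul]
  have hI : ∀ m : ℝ, ∫ y in Set.Ioi ε, gaussianPDFReal m (2 * μ) y
      = 1 / 2 * erfc ((ε - m) / (2 * √μ)) := by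
    intro m
    rw [← gaussianReal_Ioi_eq_erfc hμ, measureReal_def, gaussianReal_apply_eq_integral _ hv,
      ENNReal.toReal_ofReal (integral_nonneg fun x => gaussianPDFReal_nonneg _ _ _)]
  rw [hI, hI, gaussDelta, sub_neg_eq_add]
  ring

lemma gaussProfile_ne_top (μ : ℝ≥0) (ε : ℝ) : gaussProfile μ ε ≠ ∞ := by
  refine ((lintegral_mono (g := fun _ => 1) fun y => ?_).trans_lt ?_).ne
  · rw [← ENNReal.ofReal_one]
    exact ENNReal.ofReal_le_ofReal (by linarith [Real.exp_pos (ε - y)])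
  · simp

/-! ### Domination by the Gaussian mechanism -/

/-- `a ≤ e^ε b + δ(ε)` for all `ε`, where `δ` is the Gaussian privacy profile of parameter `μ`. -/
def ProfileLE (μ : ℝ≥0) (a b : ℝ≥0∞) : Prop :=
  ∀ ε : ℝ, a ≤ ENNReal.ofReal (Real.exp ε) * b + gaussProfile μ ε

/-- The pair of laws `(P, Q)` is no easier to distinguish than a Gaussian mechanism with privacy
loss `N(μ, 2μ)`. The condition is phrased by what happens when `P` and `Q` are followed by a
further experiment, with outcomes `F z` and `G z` when continued from the state `z`: a
`ν`-bound for the continuation gives a `(μ + ν)`-bound for the whole. In this form, sequential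
composition of mechanisms is immediate. -/
def GaussDominated {Ω : Type*} [MeasurableSpace Ω] (μ : ℝ≥0) (P Q : Measure Ω) : Prop :=
  ∀ (ν : ℝ≥0) (F G : Ω → ℝ≥0∞), Measurable F → Measurable G → (∀ z, ProfileLE ν (F z) (G z)) →
    ProfileLE (μ + ν) (∫⁻ z, F z ∂P) (∫⁻ z, G z ∂Q)

lemma ProfileLE.mono {μ ν : ℝ≥0} {a b : ℝ≥0∞} (h : ProfileLE μ a b) (hμν : μ ≤ ν) :
    ProfileLE ν a b := fun ε => (h ε).trans (by gcongr; exact gaussProfile_mono hμν ε)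

lemma profileLE_self {a : ℝ≥0∞} (ha : a ≤ 1) : ProfileLE 0 a a := by
  intro ε
  rw [gaussProfile_zero]
  have h1 : (1 : ℝ≥0∞) ≤ ENNReal.ofReal (Real.exp ε) + ENNReal.ofReal (1 - Real.exp ε) := by
    rw [← ENNReal.ofReal_one]
    refine le_trans (ENNReal.ofReal_le_ofReal ?_) ENNReal.ofReal_add_le
    linarith
  calc a = 1 * a := (one_mul a).symm
    _ ≤ (ENNReal.ofReal (Real.exp ε) + ENNReal.ofReal (1 - Real.exp ε)) * a := by gcongr
    _ = ENNReal.ofReal (Real.exp ε) * a + ENNReal.ofReal (1 - Real.exp ε) * a := add_mul _ _ _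
    _ ≤ ENNReal.ofReal (Real.exp ε) * a + ENNReal.ofReal (1 - Real.exp ε) * 1 := by gcongr
    _ = _ := by rw [mul_one]

namespace GaussDominated

variable {Ω Ω' : Type*} [MeasurableSpace Ω] [MeasurableSpace Ω'] {μ ν : ℝ≥0} {P Q : Measure Ω}

lemma mono (h : GaussDominated μ P Q) (hμν : μ ≤ ν) : GaussDominated ν P Q :=
  fun _ F G hF hG hFG => (h _ F G hF hG hFG).mono (by gcongr)

lemma refl (P : Measure Ω) [IsProbabilityMeasure P] : GaussDominated 0 P P := by
  intro ν F G _ hG hFG ε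
  rw [zero_add]
  calc ∫⁻ z, F z ∂P
      ≤ ∫⁻ z, (ENNReal.ofReal (Real.exp ε) * G z + gaussProfile ν ε) ∂P :=
        lintegral_mono fun z => hFG z ε
    _ = _ := by
        rw [lintegral_add_left (hG.const_mul _), lintegral_const_mul _ hG]
        simp

lemma map (h : GaussDominated μ P Q) {f : Ω → Ω'} (hf : Measurable f) :
    GaussDominated μ (P.map f) (Q.map f) := by
  intro ν F G hF hG hFG
  rw [lintegral_map hF hf, lintegral_map hG hf]
  exact h ν _ _ (hF.comp hf) (hG.comp hf) fun z => hFG (f z)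

/-- Adaptive sequential composition. -/
lemma bind (h : GaussDominated μ P Q) {κ κ' : Ω → Measure Ω'} (hκ : Measurable κ)
    (hκ' : Measurable κ') (hκκ' : ∀ z, GaussDominated ν (κ z) (κ' z)) :
    GaussDominated (μ + ν) (P.bind κ) (Q.bind κ') := by
  intro ρ F G hF hG hFG
  rw [Measure.lintegral_bind hκ.aemeasurable hF.aemeasurable,
    Measure.lintegral_bind hκ'.aemeasurable hG.aemeasurable, add_assoc]
  exact h _ _ _ ((Measure.measurable_lintegral hF).comp hκ)
    ((Measure.measurable_lintegral hG).comp hκ') fun z => hκκ' z ρ F G hF hG hFG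

lemma prod (h : GaussDominated μ P Q) {P' Q' : Measure Ω'} [SFinite P'] [SFinite Q']
    (h' : GaussDominated ν P' Q') : GaussDominated (μ + ν) (P.prod P') (Q.prod Q') := by
  intro ρ F G hF hG hFG
  rw [lintegral_prod _ hF.aemeasurable, lintegral_prod _ hG.aemeasurable, add_assoc]
  exact h _ _ _ hF.lintegral_prod_right' hG.lintegral_prod_right' fun z =>
    h' ρ _ _ (hF.comp measurable_prodMk_left) (hG.comp measurable_prodMk_left)
      fun w => hFG (z, w)

lemma pi {d : ℕ} {μ : Fin d → ℝ≥0} {P Q : Fin d → Measure ℝ}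
    [∀ i, IsProbabilityMeasure (P i)] [∀ i, IsProbabilityMeasure (Q i)]
    (h : ∀ i, GaussDominated (μ i) (P i) (Q i)) :
    GaussDominated (∑ i, μ i) (Measure.pi P) (Measure.pi Q) := by
  induction d with
  | zero =>
    rw [Measure.pi_of_empty P, Measure.pi_of_empty Q, Finset.univ_eq_empty, Finset.sum_empty]
    exact GaussDominated.refl _
  | succ d ih =>
    rw [← (measurePreserving_piFinSuccAbove P 0).symm.map_eq,
      ← (measurePreserving_piFinSuccAbove Q 0).symm.map_eq, Fin.sum_univ_succ]
    refine GaussDominated.map ?_ (MeasurableEquiv.measurable _)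
    exact (h 0).prod (ih fun i => h i.succ)

/-- The Gaussian mechanism: the log-likelihood ratio `Λ` of `N(a, v)` to `N(b, v)` is affine, and
its law under `N(a, v)` is `N(m, 2m)` with `m = (a - b)² / (2v)`. -/
lemma gaussianReal {a b : ℝ} {v : ℝ≥0} (hv : v ≠ 0) (h : (a - b) ^ 2 / (2 * v) ≤ (μ : ℝ)) :
    GaussDominated μ (gaussianReal a v) (ProbabilityTheory.gaussianReal b v) := by
  have hv' : (0 : ℝ) < v := by positivity
  set m : ℝ≥0 := ⟨(a - b) ^ 2 / (2 * v), by positivity⟩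
  have hm : (m : ℝ) = (a - b) ^ 2 / (2 * v) := rfl
  refine GaussDominated.mono (μ := m) ?_ (by exact_mod_cast h)
  intro ν F G hF hG hFG ε
  set Λ : ℝ → ℝ := fun y => (a - b) / v * y + (b ^ 2 - a ^ 2) / (2 * v) with hΛ
  have hΛm : Measurable Λ := by fun_prop
  have hlaw : (ProbabilityTheory.gaussianReal a v).map Λ
      = ProbabilityTheory.gaussianReal m (2 * m) := by
    have : Λ = (fun y => y + (b ^ 2 - a ^ 2) / (2 * v)) ∘ fun y => (a - b) / v * y := rfl
    rw [this, ← Measure.map_map (by fun_prop) (by fun_prop), gaussianReal_map_const_mul,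
      gaussianReal_map_add_const]
    congr 1
    · rw [hm]
      field_simp
      ring
    · ext
      rw [NNReal.coe_mul, NNReal.coe_mul, NNReal.coe_ofNat, hm]
      simp only [NNReal.coe_mk]
      field_simp
  have hdens : ∀ y, gaussianPDF a v y * ENNReal.ofReal (Real.exp (-Λ y)) = gaussianPDF b v y := by
    intro y
    rw [gaussianPDF, gaussianPDF, ← ENNReal.ofReal_mul (gaussianPDFReal_nonneg _ _ _)]
    congr 1
    simp only [gaussianPDFReal]
    rw [mul_assoc, ← Real.exp_add]
    congr 2
    simp only [hΛ]
    field_simp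
    ring
  have hchange : ∫⁻ y, ENNReal.ofReal (Real.exp (-Λ y)) * G y ∂ProbabilityTheory.gaussianReal a v
      = ∫⁻ y, G y ∂ProbabilityTheory.gaussianReal b v := by
    rw [gaussianReal_of_var_ne_zero _ hv, gaussianReal_of_var_ne_zero _ hv,
      lintegral_withDensity_eq_lintegral_mul _ (measurable_gaussianPDF _ _) (by fun_prop),
      lintegral_withDensity_eq_lintegral_mul _ (measurable_gaussianPDF _ _) hG]
    refine lintegral_congr fun y => ?_
    simp only [Pi.mul_apply]
    rw [← mul_assoc, hdens]
  calc ∫⁻ y, F y ∂ProbabilityTheory.gaussianReal a v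
      ≤ ∫⁻ y, (ENNReal.ofReal (Real.exp ε) * (ENNReal.ofReal (Real.exp (-Λ y)) * G y)
          + gaussProfile ν (ε - Λ y)) ∂ProbabilityTheory.gaussianReal a v := by
        refine lintegral_mono fun y => (hFG y (ε - Λ y)).trans_eq ?_
        rw [← mul_assoc, ← ENNReal.ofReal_mul (Real.exp_pos _).le, ← Real.exp_add, sub_eq_add_neg]
    _ = _ := by
        rw [lintegral_add_left (by fun_prop), lintegral_const_mul _ (by fun_prop), hchange]
        congr 1
        have hmeas : Measurable fun x => gaussProfile ν (ε - x) := by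
          unfold gaussProfile
          refine Measurable.lintegral_prod_right' (f := fun p : ℝ × ℝ =>
            ENNReal.ofReal (1 - Real.exp (ε - p.1 - p.2))) (by fun_prop)
        rw [← lintegral_gaussProfile_sub, ← hlaw, lintegral_map hmeas hΛm]

lemma measureReal_le (h : GaussDominated μ P Q) (hμ : 0 < μ) [IsProbabilityMeasure P]
    [IsProbabilityMeasure Q] (ε : ℝ) {S : Set Ω} (hS : MeasurableSet S) :
    P.real S ≤ Real.exp ε * Q.real S + gaussDelta μ ε := by
  have h1 := h 0 (S.indicator 1) (S.indicator 1) (measurable_one.indicator hS)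
    (measurable_one.indicator hS)
    (fun z => profileLE_self (Set.indicator_le_self' (by simp) z)) ε
  rw [lintegral_indicator_one hS, lintegral_indicator_one hS, add_zero] at h1
  have hfin : ENNReal.ofReal (Real.exp ε) * Q S ≠ ∞ :=
    ENNReal.mul_ne_top ENNReal.ofReal_ne_top (measure_ne_top _ _)
  have h2 := ENNReal.toReal_mono
    (ENNReal.add_ne_top.2 ⟨hfin, gaussProfile_ne_top μ ε⟩) h1
  rwa [ENNReal.toReal_add hfin (gaussProfile_ne_top μ ε), ENNReal.toReal_mul,
    ENNReal.toReal_ofReal (Real.exp_pos _).le, toReal_gaussProfile hμ] at h2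

end GaussDominated

/-! ### Measurability of parametrised laws -/

section Parametrised

variable {α β γ : Type*} [MeasurableSpace α] [MeasurableSpace β] [MeasurableSpace γ]

lemma measurable_map_of_uncurry {ν : Measure β} [SFinite ν] {f : α → β → γ}
    (hf : Measurable (Function.uncurry f)) : Measurable fun a => ν.map (f a) := by
  have h : (fun a => ν.map (f a)) = fun a => (ν.map (Prod.mk a)).map (Function.uncurry f) := by
    funext a
    rw [Measure.map_map hf measurable_prodMk_left]
    rfl
  rw [h]
  exact (Measure.measurable_map _ hf).comp Measurable.map_prodMk_left

lemma measurable_bind_of_uncurry {κ : α → Measure β} (hκ : Measurable κ)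
    [∀ a, IsProbabilityMeasure (κ a)] {ρ : α → β → Measure γ}
    (hρ : Measurable (Function.uncurry ρ)) : Measurable fun a => (κ a).bind (ρ a) := by
  let K : Kernel α β := ⟨κ, hκ⟩
  have : IsMarkovKernel K := ⟨fun a => inferInstanceAs (IsProbabilityMeasure (κ a))⟩
  refine Measure.measurable_of_measurable_coe _ fun s hs => ?_
  have h : (fun a => (κ a).bind (ρ a) s) = fun a => ∫⁻ b, ρ a b s ∂K a := by
    funext a
    rw [Measure.bind_apply hs hρ.of_uncurry_left.aemeasurable]
    rfl
  rw [h]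
  exact Measurable.lintegral_kernel_prod_right ((Measure.measurable_coe hs).comp hρ)

lemma isProbabilityMeasure_bind_of_forall {m : Measure α} [IsProbabilityMeasure m]
    {κ : α → Measure β} (hκ : Measurable κ) (h : ∀ a, IsProbabilityMeasure (κ a)) :
    IsProbabilityMeasure (m.bind κ) :=
  isProbabilityMeasure_bind hκ.aemeasurable (ae_of_all _ h)

end Parametrised

/-! ### Clipping and sensitivity -/

section Clip

variable {E : Type*} [NormedAddCommGroup E] [NormedSpace ℝ E]

lemma norm_clip_le {b : ℝ} (hb : 0 ≤ b) (y : E) : ‖clip b y‖ ≤ b := by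
  have h0 : 0 ≤ min (b / ‖y‖) 1 := le_min (by positivity) zero_le_one
  rw [clip, norm_smul, Real.norm_of_nonneg h0]
  calc min (b / ‖y‖) 1 * ‖y‖ ≤ b / ‖y‖ * ‖y‖ := by gcongr; exact min_le_left _ _
    _ ≤ b := by
      rcases eq_or_ne ‖y‖ 0 with h | h
      · simpa [h] using hb
      · rw [div_mul_cancel₀ _ h]

lemma measurable_clip [MeasurableSpace E] [BorelSpace E] [SecondCountableTopology E] :
    Measurable fun p : ℝ × E => clip p.1 p.2 := by
  unfold clip
  fun_prop

/-- A sum of clipped contributions of the rows of a dataset has sensitivity `2 b`. -/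
lemma SubstNeighbour.norm_sum_clip_sub_le {n dx : ℕ} {X X' : Dataset n dx}
    (h : SubstNeighbour X X') {b : ℝ} (hb : 0 ≤ b) (f : (Fin dx → ℝ) → E) :
    ‖∑ i, clip b (f (X i)) - ∑ i, clip b (f (X' i))‖ ≤ 2 * b := by
  rw [← Finset.sum_sub_distrib]
  by_cases hX : ∃ i, X i ≠ X' i
  · obtain ⟨i, hi⟩ := hX
    rw [Finset.sum_eq_single_of_mem i (Finset.mem_univ i)]
    · calc _ ≤ ‖clip b (f (X i))‖ + ‖clip b (f (X' i))‖ := norm_sub_le _ _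
        _ ≤ 2 * b := by linarith [norm_clip_le hb (f (X i)), norm_clip_le hb (f (X' i))]
    · intro j _ hji
      have : X j = X' j := by
        by_contra hj
        exact hji (Set.encard_le_one_iff.1 h j i hj hi)
      rw [this, sub_self]
  · push Not at hX
    simp only [hX, sub_self, Finset.sum_const_zero, norm_zero]
    positivity

end Clip

/-! ### The Gaussian noise of the algorithm -/

lemma multivariateGaussian_smul_one {d : ℕ} (v : ℝ≥0) :
    multivariateGaussian 0 ((v : ℝ) • (1 : Matrix (Fin d) (Fin d) ℝ))
      = (Measure.pi fun _ : Fin d => gaussianReal 0 v).map (WithLp.toLp 2) := by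
  have hS : ((v : ℝ) • (1 : Matrix (Fin d) (Fin d) ℝ)).PosSemidef :=
    Matrix.PosSemidef.one.smul v.2
  have : IsProbabilityMeasure ((Measure.pi fun _ : Fin d => gaussianReal 0 v).map
      (WithLp.toLp 2 : (Fin d → ℝ) → Vec d)) :=
    Measure.isProbabilityMeasure_map (by fun_prop)
  apply Measure.ext_of_charFun (E := Vec d)
  ext t
  rw [charFun_multivariateGaussian hS]
  simp_rw [charFun_pi, charFun_gaussianReal, ← Complex.exp_sum]
  congr 1
  simp [smul_mulVec, dotProduct, Finset.sum_div, sub_eq_add_neg,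
    Finset.sum_neg_distrib]
  refine Finset.sum_congr rfl fun i _ => ?_
  ring

/-- The `d`-dimensional Gaussian mechanism with isotropic noise. Its coordinates are independent
one-dimensional mechanisms, whose parameters `(aᵢ - bᵢ)² / (2v)` add up. -/
lemma gaussDominated_multivariateGaussian {d : ℕ} {v : ℝ} (hv : 0 < v) {μ : ℝ≥0} (a b : Vec d)
    (h : ‖a - b‖ ^ 2 / (2 * v) ≤ μ) :
    GaussDominated μ
      ((multivariateGaussian 0 (v • (1 : Matrix (Fin d) (Fin d) ℝ))).map fun ξ => a + ξ)
      ((multivariateGaussian 0 (v • (1 : Matrix (Fin d) (Fin d) ℝ))).map fun ξ => b + ξ) := by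
  lift v to ℝ≥0 using hv.le
  have hv0 : v ≠ 0 := by rintro rfl; simp at hv
  have key : ∀ c : Vec d,
      (multivariateGaussian 0 ((v : ℝ) • (1 : Matrix (Fin d) (Fin d) ℝ))).map (fun ξ => c + ξ)
        = (Measure.pi fun i => gaussianReal (c i) v).map (WithLp.toLp 2) := by
    intro c
    have hpi : (Measure.pi fun i => gaussianReal (c i) v)
        = (Measure.pi fun _ : Fin d => gaussianReal 0 v).map fun x i => c i + x i := by
      rw [Measure.pi_map_pi (f := fun i x => c i + x) (fun i => by fun_prop)]
      simp_rw [gaussianReal_map_const_add, zero_add]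
    rw [multivariateGaussian_smul_one, hpi, Measure.map_map (by fun_prop) (by fun_prop),
      Measure.map_map (by fun_prop) (by fun_prop)]
    rfl
  rw [key, key]
  refine GaussDominated.map ?_ (by fun_prop)
  let m : Fin d → ℝ≥0 := fun i => ⟨(a i - b i) ^ 2 / (2 * v), by positivity⟩
  refine GaussDominated.mono (μ := ∑ i, m i) ?_ ?_
  · exact GaussDominated.pi fun i => GaussDominated.gaussianReal hv0 le_rfl
  · rw [← NNReal.coe_le_coe, NNReal.coe_sum]
    refine le_of_eq_of_le ?_ h
    rw [EuclideanSpace.real_norm_sq_eq, Finset.sum_div]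
    rfl

/-- Any one-dimensional Gaussian law, degenerate ones included, is an affine image of the standard
one. -/
lemma map_add_sqrt_mul_gaussianReal (R : ℝ) {v : ℝ} (hv : 0 ≤ v) :
    (gaussianReal 0 1).map (fun y => R + √v * y) = gaussianReal R v.toNNReal := by
  have : (fun y => R + √v * y) = (fun y => R + y) ∘ fun y => √v * y := rfl
  rw [this, ← Measure.map_map (by fun_prop) (by fun_prop), gaussianReal_map_const_mul,
    gaussianReal_map_const_add, mul_zero, zero_add]
  congr 1
  ext
  simp [Real.sq_sqrt hv, hv]

/-! ### The noisy leapfrog simulation -/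

namespace Input

variable {d dx n : ℕ} (A : Input d dx)

/-- What the privacy analysis uses about the input: positive noise and clip parameters, and a
measurable log-likelihood and log-prior for which `log` turns the ratios of densities into
differences. -/
structure Regular : Prop where
  τl_pos : 0 < A.τl
  τg_pos : 0 < A.τg
  bl_pos : 0 < A.bl
  bg_pos : 0 < A.bg
  measurable_log_lik : ∀ x, Measurable fun θ => Real.log (A.lik x θ)
  log_lik_div : ∀ x θ θ',
    Real.log (A.lik x θ' / A.lik x θ) = Real.log (A.lik x θ') - Real.log (A.lik x θ)
  measurable_log_prior : Measurable fun θ => Real.log (A.prior θ)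
  log_prior_div : ∀ θ θ',
    Real.log (A.prior θ' / A.prior θ) = Real.log (A.prior θ') - Real.log (A.prior θ)

/-- The privacy parameter of one momentum update. -/
noncomputable def gradCost : ℝ≥0 := (1 / (2 * A.τg ^ 2)).toNNReal

/-- The privacy parameter of one acceptance test. -/
noncomputable def ratioCost : ℝ≥0 := (1 / (2 * A.τl ^ 2)).toNNReal

/-- The privacy parameter of one iteration. -/
noncomputable def iterationCost : ℝ≥0 := (A.L + 1) * A.gradCost + A.ratioCost

@[fun_prop]
lemma measurable_clippedGrad (X : Dataset n dx) : Measurable (A.clippedGrad X) := by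
  have hgrad : ∀ f : Vec d → ℝ, Measurable (gradient f) := fun f =>
    (InnerProductSpace.toDual ℝ (Vec d)).symm.continuous.measurable.comp (measurable_fderiv ℝ f)
  have h : ∀ i, Measurable fun θ =>
      clip A.bg (gradient (fun t => Real.log (A.lik (X i) t)) θ) := fun i =>
    measurable_clip.comp (measurable_const.prodMk (hgrad _))
  unfold clippedGrad
  exact ((Finset.measurable_sum _ fun i _ => h i).add (hgrad _)).const_smul _

@[fun_prop]
lemma measurable_velocity : Measurable A.velocity := by
  unfold velocity
  have : Measurable fun p : Vec d => A.M⁻¹ *ᵥ p.ofLp :=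
    (Continuous.matrix_mulVec continuous_const (by fun_prop)).measurable
  fun_prop

@[fun_prop]
lemma measurable_kinetic : Measurable A.kinetic := by
  unfold kinetic
  exact (Continuous.const_mul (Continuous.dotProduct (by fun_prop)
    (Continuous.matrix_mulVec continuous_const (by fun_prop))) _).measurable

@[fun_prop]
lemma measurable_positionStep (η : ℝ) : Measurable (A.positionStep η) := by
  unfold positionStep
  fun_prop

lemma norm_clippedGrad_sub_le {X X' : Dataset n dx} (h : SubstNeighbour X X') (hb : 0 ≤ A.bg)
    (θ : Vec d) : ‖A.clippedGrad X θ - A.clippedGrad X' θ‖ ≤ 2 * A.bg := by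
  have key := h.norm_sum_clip_sub_le hb
    fun x => gradient (fun t => Real.log (A.lik x t)) θ
  unfold clippedGrad
  rw [← smul_sub, add_sub_add_right_eq_sub]
  rcases Int.units_eq_one_or A.sgn with hs | hs
  · simpa [hs] using key
  · simpa [hs, norm_sub_rev] using key

lemma measurable_momentumStep (X : Dataset n dx) (s : ℝ) : Measurable (A.momentumStep X s) :=
  measurable_map_of_uncurry (f := fun (z : Vec d × Vec d) ξ =>
    (z.1, z.2 - s • (A.clippedGrad X z.1 + ξ))) (by unfold Function.uncurry; fun_prop)

instance (X : Dataset n dx) (s : ℝ) (z : Vec d × Vec d) :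
    IsProbabilityMeasure (A.momentumStep X s z) :=
  Measure.isProbabilityMeasure_map (by fun_prop)

lemma gaussDominated_momentumStep (hA : A.Regular) {X X' : Dataset n dx}
    (h : SubstNeighbour X X') (s : ℝ) (z : Vec d × Vec d) :
    GaussDominated A.gradCost (A.momentumStep X s z) (A.momentumStep X' s z) := by
  have hτ := hA.τg_pos
  have hb := hA.bg_pos
  have hv : 0 < A.gradVar := by unfold gradVar; positivity
  have hfac : ∀ Y : Dataset n dx, A.momentumStep Y s z
      = ((multivariateGaussian 0 (A.gradVar • (1 : Matrix (Fin d) (Fin d) ℝ))).map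
          fun ξ => A.clippedGrad Y z.1 + ξ).map fun ζ => (z.1, z.2 - s • ζ) := fun Y => by
    rw [Measure.map_map (by fun_prop) (by fun_prop)]
    rfl
  rw [hfac, hfac]
  refine (gaussDominated_multivariateGaussian hv _ _ ?_).map (by fun_prop)
  rw [gradCost, Real.coe_toNNReal _ (by positivity)]
  calc _ ≤ (2 * A.bg) ^ 2 / (2 * A.gradVar) := by
        gcongr
        exact A.norm_clippedGrad_sub_le h hb.le z.1
    _ = _ := by
        unfold gradVar
        field_simp
        norm_num

lemma measurable_leapfrogLoop (X : Dataset n dx) (η : ℝ) (m : ℕ) :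
    Measurable (A.leapfrogLoop X η m) := by
  induction m with
  | zero => exact Measure.measurable_dirac
  | succ m ih =>
    exact (Measure.measurable_bind'
      ((A.measurable_momentumStep X η).comp (A.measurable_positionStep η))).comp ih

instance isProbabilityMeasure_leapfrogLoop (X : Dataset n dx) (η : ℝ) (m : ℕ)
    (z : Vec d × Vec d) : IsProbabilityMeasure (A.leapfrogLoop X η m z) := by
  induction m with
  | zero => exact inferInstanceAs (IsProbabilityMeasure (Measure.dirac z))
  | succ m ih =>
    exact isProbabilityMeasure_bind_of_forall
      ((A.measurable_momentumStep X η).comp (A.measurable_positionStep η)) fun _ => inferInstance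

lemma gaussDominated_leapfrogLoop (hA : A.Regular) {X X' : Dataset n dx}
    (h : SubstNeighbour X X') (η : ℝ) (m : ℕ) (z : Vec d × Vec d) :
    GaussDominated (m * A.gradCost) (A.leapfrogLoop X η m z) (A.leapfrogLoop X' η m z) := by
  induction m with
  | zero =>
    rw [Nat.cast_zero, zero_mul]
    exact GaussDominated.refl (Measure.dirac z)
  | succ m ih =>
    rw [Nat.cast_succ, add_one_mul]
    exact ih.bind ((A.measurable_momentumStep X η).comp (A.measurable_positionStep η))
      ((A.measurable_momentumStep X' η).comp (A.measurable_positionStep η))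
      fun z' => A.gaussDominated_momentumStep hA h η _

lemma measurable_leapfrog_tail (X : Dataset n dx) (η : ℝ) :
    Measurable fun z₁ => (A.leapfrogLoop X η (A.L - 1) z₁).bind fun z₂ =>
      A.momentumStep X (η / 2) (A.positionStep η z₂) :=
  (Measure.measurable_bind' ((A.measurable_momentumStep X (η / 2)).comp
    (A.measurable_positionStep η))).comp (A.measurable_leapfrogLoop X η _)

lemma measurable_leapfrog (X : Dataset n dx) (η : ℝ) : Measurable (A.leapfrog X η) :=
  (Measure.measurable_bind' (A.measurable_leapfrog_tail X η)).comp
    (A.measurable_momentumStep X (η / 2))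

instance (X : Dataset n dx) (η : ℝ) (z : Vec d × Vec d) :
    IsProbabilityMeasure (A.leapfrog X η z) :=
  isProbabilityMeasure_bind_of_forall (A.measurable_leapfrog_tail X η) fun _ =>
    isProbabilityMeasure_bind_of_forall ((A.measurable_momentumStep X (η / 2)).comp
      (A.measurable_positionStep η)) fun _ => inferInstance

lemma gaussDominated_leapfrog (hA : A.Regular) (hL : 1 ≤ A.L) {X X' : Dataset n dx}
    (h : SubstNeighbour X X') (η : ℝ) (z : Vec d × Vec d) :
    GaussDominated ((A.L + 1) * A.gradCost) (A.leapfrog X η z) (A.leapfrog X' η z) := by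
  have hcost : ((A.L : ℝ≥0) + 1) * A.gradCost
      = A.gradCost + (((A.L - 1 : ℕ) : ℝ≥0) * A.gradCost + A.gradCost) := by
    obtain ⟨m, hm⟩ := Nat.exists_eq_add_of_le' hL
    rw [hm, Nat.add_sub_cancel, Nat.cast_succ]
    ring
  -- The two half updates and the `L - 1` full updates each cost `gradCost`, whatever the step size.
  rw [hcost]
  exact (A.gaussDominated_momentumStep hA h (η / 2) z).bind
    (A.measurable_leapfrog_tail X η) (A.measurable_leapfrog_tail X' η) fun z₁ =>
    (A.gaussDominated_leapfrogLoop hA h η _ z₁).bind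
      ((A.measurable_momentumStep X _).comp (A.measurable_positionStep η))
      ((A.measurable_momentumStep X' _).comp (A.measurable_positionStep η))
      fun z₂ => A.gaussDominated_momentumStep hA h (η / 2) _

/-! ### The noisy acceptance test -/

@[fun_prop]
lemma measurable_ratioVar : Measurable fun p : Vec d × Vec d => A.ratioVar p.1 p.2 := by
  unfold ratioVar ratioClip
  fun_prop

lemma measurable_clippedRatio (hA : A.Regular) (X : Dataset n dx) :
    Measurable fun p : Vec d × Vec d => A.clippedRatio X p.1 p.2 := by
  unfold clippedRatio
  refine Finset.measurable_sum _ fun i _ => ?_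
  simp_rw [hA.log_lik_div]
  have h := hA.measurable_log_lik (X i)
  refine measurable_clip.comp (Measurable.prodMk (f := fun p : Vec d × Vec d => A.ratioClip p.1 p.2)
    (by unfold ratioClip; fun_prop) ?_)
  exact (h.comp measurable_snd).sub (h.comp measurable_fst)

open Classical in
/-- The acceptance test given the noisy clipped log-likelihood ratio `r`. It does not depend on
the data. -/
noncomputable def acceptGiven (z z' : Vec d × Vec d) (r : ℝ) : Measure (Vec d) :=
  (volume.restrict (Set.Ioo (0 : ℝ) 1)).map fun u =>
    if Real.log u < r + (A.kinetic z.2 - A.kinetic z'.2)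
      + Real.log (A.prior z'.1 / A.prior z.1) - 1 / 2 * A.ratioVar z.1 z'.1 then z'.1 else z.1

lemma measurable_uncurry_acceptGiven (hA : A.Regular) :
    Measurable fun q : ((Vec d × Vec d) × (Vec d × Vec d)) × ℝ =>
      A.acceptGiven q.1.1 q.1.2 q.2 := by
  classical
  have hp := hA.measurable_log_prior
  refine measurable_map_of_uncurry ?_
  refine Measurable.ite (measurableSet_lt (by fun_prop) ?_) (by fun_prop) (by fun_prop)
  simp_rw [hA.log_prior_div]
  have h' : Measurable fun a : (((Vec d × Vec d) × (Vec d × Vec d)) × ℝ) × ℝ =>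
      Real.log (A.prior a.1.1.2.1) := hp.comp
        (f := fun a : (((Vec d × Vec d) × (Vec d × Vec d)) × ℝ) × ℝ => a.1.1.2.1) (by fun_prop)
  have h : Measurable fun a : (((Vec d × Vec d) × (Vec d × Vec d)) × ℝ) × ℝ =>
      Real.log (A.prior a.1.1.1.1) := hp.comp
        (f := fun a : (((Vec d × Vec d) × (Vec d × Vec d)) × ℝ) × ℝ => a.1.1.1.1) (by fun_prop)
  have hV : Measurable fun a : (((Vec d × Vec d) × (Vec d × Vec d)) × ℝ) × ℝ =>
      A.ratioVar a.1.1.1.1 a.1.1.2.1 := A.measurable_ratioVar.comp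
        (f := fun a : (((Vec d × Vec d) × (Vec d × Vec d)) × ℝ) × ℝ => (a.1.1.1.1, a.1.1.2.1))
        (by fun_prop)
  fun_prop

lemma measurable_acceptGiven (hA : A.Regular) (z z' : Vec d × Vec d) :
    Measurable (A.acceptGiven z z') :=
  (A.measurable_uncurry_acceptGiven hA).comp (measurable_prodMk_left (x := (z, z')))

lemma isProbabilityMeasure_acceptGiven (z z' : Vec d × Vec d) (r : ℝ) :
    IsProbabilityMeasure (A.acceptGiven z z' r) := by
  classical
  have : IsProbabilityMeasure (volume.restrict (Set.Ioo (0 : ℝ) 1)) := ⟨by simp⟩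
  refine Measure.isProbabilityMeasure_map (Measurable.aemeasurable ?_)
  exact Measurable.ite (measurableSet_lt (by fun_prop) (by fun_prop)) (by fun_prop) (by fun_prop)

/-- The data enter the acceptance test only through the Gaussian mechanism applied to the clipped
log-likelihood ratio. -/
lemma acceptStep_eq_bind (hA : A.Regular) (X : Dataset n dx) (z z' : Vec d × Vec d) :
    A.acceptStep X z z'
      = ((gaussianReal 0 1).map fun y =>
          A.clippedRatio X z.1 z'.1 + √(A.ratioVar z.1 z'.1) * y).bind (A.acceptGiven z z') := by
  have hv : 0 ≤ A.ratioVar z.1 z'.1 := by unfold ratioVar; positivity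
  have hstd : gaussianReal 0 (A.ratioVar z.1 z'.1).toNNReal
      = (gaussianReal 0 1).map fun y => √(A.ratioVar z.1 z'.1) * y := by
    simpa using (map_add_sqrt_mul_gaussianReal 0 hv).symm
  have hm := A.measurable_acceptGiven hA z z'
  have hstep : A.acceptStep X z z' = (gaussianReal 0 (A.ratioVar z.1 z'.1).toNNReal).bind
      fun ξ => A.acceptGiven z z' (A.clippedRatio X z.1 z'.1 + ξ) := by
    unfold acceptStep acceptGiven deltaH
    simp only [add_right_comm _ _ (_ : ℝ), add_comm]
  rw [hstep, hstd]
  ext s hs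
  rw [Measure.bind_apply hs (by fun_prop), Measure.bind_apply hs (by fun_prop),
    lintegral_map (f := fun r => A.acceptGiven z z' (A.clippedRatio X z.1 z'.1 + r) s)
      ((Measure.measurable_coe hs).comp (hm.comp (by fun_prop))) (by fun_prop),
    lintegral_map (f := fun r => A.acceptGiven z z' r s)
      ((Measure.measurable_coe hs).comp hm) (by fun_prop)]

lemma measurable_acceptStep (hA : A.Regular) (X : Dataset n dx) :
    Measurable (Function.uncurry (A.acceptStep X)) := by
  unfold Function.uncurry
  simp_rw [A.acceptStep_eq_bind hA X]
  have hR := A.measurable_clippedRatio hA X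
  have hR' : Measurable fun q : (Vec d × Vec d) × (Vec d × Vec d) =>
      A.clippedRatio X q.1.1 q.2.1 := hR.comp (f := fun q : (Vec d × Vec d) × (Vec d × Vec d) =>
        (q.1.1, q.2.1)) (by fun_prop)
  have hV : Measurable fun q : (Vec d × Vec d) × (Vec d × Vec d) =>
      A.ratioVar q.1.1 q.2.1 := A.measurable_ratioVar.comp
        (f := fun q : (Vec d × Vec d) × (Vec d × Vec d) => (q.1.1, q.2.1)) (by fun_prop)
  have := fun q : (Vec d × Vec d) × (Vec d × Vec d) => Measure.isProbabilityMeasure_map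
    (μ := gaussianReal 0 1) (f := fun y : ℝ =>
      A.clippedRatio X q.1.1 q.2.1 + √(A.ratioVar q.1.1 q.2.1) * y) (by fun_prop)
  refine measurable_bind_of_uncurry (measurable_map_of_uncurry ?_)
    (A.measurable_uncurry_acceptGiven hA)
  unfold Function.uncurry
  fun_prop

lemma isProbabilityMeasure_acceptStep (hA : A.Regular) (X : Dataset n dx)
    (z z' : Vec d × Vec d) : IsProbabilityMeasure (A.acceptStep X z z') := by
  rw [A.acceptStep_eq_bind hA]
  have : IsProbabilityMeasure ((gaussianReal 0 1).map fun y =>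
      A.clippedRatio X z.1 z'.1 + √(A.ratioVar z.1 z'.1) * y) :=
    Measure.isProbabilityMeasure_map (by fun_prop)
  exact isProbabilityMeasure_bind_of_forall (A.measurable_acceptGiven hA z z')
    (A.isProbabilityMeasure_acceptGiven z z')

lemma gaussDominated_acceptStep (hA : A.Regular) {X X' : Dataset n dx} (h : SubstNeighbour X X')
    (z z' : Vec d × Vec d) :
    GaussDominated A.ratioCost (A.acceptStep X z z') (A.acceptStep X' z z') := by
  have hτ := hA.τl_pos
  have hb := hA.bl_pos
  set c := A.ratioClip z.1 z'.1 with hc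
  have hc0 : 0 ≤ c := by rw [hc, ratioClip]; positivity
  have hsens : |A.clippedRatio X z.1 z'.1 - A.clippedRatio X' z.1 z'.1| ≤ 2 * c :=
    h.norm_sum_clip_sub_le hc0 fun x => Real.log (A.lik x z'.1 / A.lik x z.1)
  have hvar : A.ratioVar z.1 z'.1 = 4 * A.τl ^ 2 * c ^ 2 := rfl
  rw [A.acceptStep_eq_bind hA, A.acceptStep_eq_bind hA, ← add_zero A.ratioCost]
  refine GaussDominated.bind ?_ (A.measurable_acceptGiven hA z z')
    (A.measurable_acceptGiven hA z z') fun r =>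
      have := A.isProbabilityMeasure_acceptGiven z z' r
      GaussDominated.refl _
  rcases hc0.eq_or_lt with hc0 | hc0
  · -- Without movement the noise vanishes, but then every clipped ratio is zero.
    rw [← hc0, mul_zero, abs_nonpos_iff, sub_eq_zero] at hsens
    rw [hsens]
    have : IsProbabilityMeasure ((gaussianReal 0 1).map fun y =>
        A.clippedRatio X' z.1 z'.1 + √(A.ratioVar z.1 z'.1) * y) :=
      Measure.isProbabilityMeasure_map (by fun_prop)
    exact (GaussDominated.refl _).mono zero_le
  · have hv : 0 < A.ratioVar z.1 z'.1 := by rw [hvar]; positivity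
    rw [map_add_sqrt_mul_gaussianReal _ hv.le, map_add_sqrt_mul_gaussianReal _ hv.le]
    refine GaussDominated.gaussianReal (by simpa using hv) ?_
    rw [Real.coe_toNNReal _ hv.le, ratioCost, Real.coe_toNNReal _ (by positivity), ← sq_abs]
    calc _ ≤ (2 * c) ^ 2 / (2 * A.ratioVar z.1 z'.1) := by gcongr
      _ = _ := by
        rw [hvar]
        field_simp
        norm_num

/-! ### One iteration -/

lemma measurable_iteration_tail (hA : A.Regular) (X : Dataset n dx) (η : ℝ) :
    Measurable (Function.uncurry fun θ p => (A.leapfrog X η (θ, p)).bind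
      fun z' => A.acceptStep X (θ, p) z') :=
  measurable_bind_of_uncurry (A.measurable_leapfrog X η) (A.measurable_acceptStep hA X)

lemma isProbabilityMeasure_iteration_tail (hA : A.Regular) (X : Dataset n dx) (η : ℝ)
    (z : Vec d × Vec d) :
    IsProbabilityMeasure ((A.leapfrog X η z).bind fun z' => A.acceptStep X z z') :=
  isProbabilityMeasure_bind_of_forall ((A.measurable_acceptStep hA X).of_uncurry_left)
    (A.isProbabilityMeasure_acceptStep hA X z)

lemma measurable_iteration (hA : A.Regular) (X : Dataset n dx) (η : ℝ) :
    Measurable (A.iteration X η) :=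
  measurable_bind_of_uncurry (κ := fun _ => multivariateGaussian 0 A.M) measurable_const
    (A.measurable_iteration_tail hA X η)

lemma isProbabilityMeasure_iteration (hA : A.Regular) (X : Dataset n dx) (η : ℝ) (θ : Vec d) :
    IsProbabilityMeasure (A.iteration X η θ) :=
  isProbabilityMeasure_bind_of_forall
    ((A.measurable_iteration_tail hA X η).of_uncurry_left)
    fun _ => A.isProbabilityMeasure_iteration_tail hA X η _

lemma gaussDominated_iteration (hA : A.Regular) (hL : 1 ≤ A.L) {X X' : Dataset n dx}
    (h : SubstNeighbour X X') (η : ℝ) (θ : Vec d) :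
    GaussDominated A.iterationCost (A.iteration X η θ) (A.iteration X' η θ) := by
  rw [← zero_add A.iterationCost]
  exact (GaussDominated.refl (multivariateGaussian 0 A.M)).bind
    ((A.measurable_iteration_tail hA X η).of_uncurry_left)
    ((A.measurable_iteration_tail hA X' η).of_uncurry_left) fun p =>
    (A.gaussDominated_leapfrog hA hL h η (θ, p)).bind
      ((A.measurable_acceptStep hA X).of_uncurry_left)
      ((A.measurable_acceptStep hA X').of_uncurry_left)
      fun z' => A.gaussDominated_acceptStep hA h (θ, p) z'

/-! ### The chain of iterates -/

lemma measurable_vecCons {k : ℕ} :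
    Measurable fun q : Vec d × (Fin k → Vec d) => (vecCons q.1 q.2 : Fin (k + 1) → Vec d) := by
  refine measurable_pi_lambda _ fun i => ?_
  refine Fin.cases ?_ (fun j => ?_) i
  · simpa using measurable_fst
  · exact (measurable_pi_apply j).comp measurable_snd

/-- The law of the remaining iterates, with the first one prepended, depends measurably on the
first iterate. -/
lemma measurable_map_vecCons {k : ℕ} {κ : Vec d → Measure (Fin k → Vec d)} (hκ : Measurable κ)
    (hp : ∀ θ, IsProbabilityMeasure (κ θ)) :
    Measurable fun θ => (κ θ).map fun w => (vecCons θ w : Fin (k + 1) → Vec d) := by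
  have heq : (fun θ => (κ θ).map fun w => (vecCons θ w : Fin (k + 1) → Vec d))
      = fun θ => (κ θ).bind fun w => Measure.dirac (vecCons θ w : Fin (k + 1) → Vec d) := by
    funext θ
    exact (Measure.bind_dirac_eq_map _ (measurable_vecCons.comp measurable_prodMk_left)).symm
  rw [heq]
  exact measurable_bind_of_uncurry hκ (Measure.measurable_dirac.comp measurable_vecCons)

lemma measurable_chain_and_isProbabilityMeasure (hA : A.Regular) (X : Dataset n dx) {k : ℕ}
    (η : Fin k → ℝ) :
    Measurable (A.chain X k η) ∧ ∀ θ, IsProbabilityMeasure (A.chain X k η θ) := by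
  induction k with
  | zero =>
    exact ⟨measurable_const,
      fun _ => inferInstanceAs (IsProbabilityMeasure (Measure.dirac Fin.elim0))⟩
  | succ k ih =>
    obtain ⟨hm, hp⟩ := ih fun i => η i.succ
    have hcons := measurable_map_vecCons hm hp
    refine ⟨(Measure.measurable_bind' hcons).comp (A.measurable_iteration hA X (η 0)),
      fun θ => ?_⟩
    have := A.isProbabilityMeasure_iteration hA X (η 0) θ
    exact isProbabilityMeasure_bind_of_forall hcons fun θ₁ => Measure.isProbabilityMeasure_map
      (measurable_vecCons.comp measurable_prodMk_left).aemeasurable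

lemma gaussDominated_chain (hA : A.Regular) (hL : 1 ≤ A.L) {X X' : Dataset n dx}
    (h : SubstNeighbour X X') {k : ℕ} (η : Fin k → ℝ) (θ : Vec d) :
    GaussDominated (k * A.iterationCost) (A.chain X k η θ) (A.chain X' k η θ) := by
  induction k generalizing θ with
  | zero =>
    rw [Nat.cast_zero, zero_mul]
    exact GaussDominated.refl (Measure.dirac Fin.elim0)
  | succ k ih =>
    obtain ⟨hm, hp⟩ := A.measurable_chain_and_isProbabilityMeasure hA X fun i => η i.succ
    obtain ⟨hm', hp'⟩ := A.measurable_chain_and_isProbabilityMeasure hA X' fun i => η i.succ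
    rw [Nat.cast_succ, add_one_mul, add_comm (_ * _)]
    exact (A.gaussDominated_iteration hA hL h (η 0) θ).bind (measurable_map_vecCons hm hp)
      (measurable_map_vecCons hm' hp') fun θ₁ =>
        (ih (fun i => η i.succ) θ₁).map (measurable_vecCons.comp measurable_prodMk_left)

end Input

end DPHMC

theorem mainTheorem3 {d dx n k : ℕ} (A : DPHMC.Input d dx) (η : Fin k → ℝ)
    (hk : 1 ≤ k) (hL : 1 ≤ A.L)
    (hτl : 0 < A.τl) (hτg : 0 < A.τg) (hbl : 0 < A.bl) (hbg : 0 < A.bg)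
    (hη : ∀ i, 0 < η i) (hM : A.M.PosDef)
    (hlik_pos : ∀ x θ, 0 < A.lik x θ)
    (hlik_diff : ∀ x, Differentiable ℝ fun θ => Real.log (A.lik x θ))
    (hprior_pos : ∀ θ, 0 < A.prior θ)
    (hprior_diff : Differentiable ℝ fun θ => Real.log (A.prior θ))
    (ε : ℝ) :
    DPHMC.IsADP (DPHMC.SubstNeighbour (n := n) (dx := dx)) (A.dpHMC η) ε
      (DPHMC.gaussDelta
        ((k : ℝ) / (2 * A.τl ^ 2) + (k : ℝ) * ((A.L : ℝ) + 1) / (2 * A.τg ^ 2)) ε) := by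
  have hA : A.Regular :=
    { τl_pos := hτl
      τg_pos := hτg
      bl_pos := hbl
      bg_pos := hbg
      measurable_log_lik := fun x => (hlik_diff x).continuous.measurable
      log_lik_div := fun x θ θ' => Real.log_div (hlik_pos x θ').ne' (hlik_pos x θ).ne'
      measurable_log_prior := hprior_diff.continuous.measurable
      log_prior_div := fun θ θ' => Real.log_div (hprior_pos θ').ne' (hprior_pos θ).ne' }
  have hprob : ∀ X : DPHMC.Dataset n dx, IsProbabilityMeasure (A.dpHMC η X) := fun X =>
    (A.measurable_chain_and_isProbabilityMeasure hA X η).2 A.θ₀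
  refine ⟨hprob, fun X X' h S hS => ?_⟩
  have hμ : ((k * A.iterationCost : NNReal) : ℝ)
      = (k : ℝ) / (2 * A.τl ^ 2) + (k : ℝ) * ((A.L : ℝ) + 1) / (2 * A.τg ^ 2) := by
    have h1 : (A.gradCost : ℝ) = 1 / (2 * A.τg ^ 2) := Real.coe_toNNReal _ (by positivity)
    have h2 : (A.ratioCost : ℝ) = 1 / (2 * A.τl ^ 2) := Real.coe_toNNReal _ (by positivity)
    simp only [DPHMC.Input.iterationCost, NNReal.coe_mul, NNReal.coe_add, NNReal.coe_natCast,
      NNReal.coe_one, h1, h2]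
    ring
  have hpos : 0 < (k * A.iterationCost : NNReal) := by
    have : (0 : ℝ) < k := by exact_mod_cast hk
    rw [← NNReal.coe_pos, hμ]
    positivity
  have : IsProbabilityMeasure (A.chain X k η A.θ₀) := hprob X
  have : IsProbabilityMeasure (A.chain X' k η A.θ₀) := hprob X'
  rw [← hμ]
  exact (A.gaussDominated_chain hA hL h η A.θ₀).measureReal_le hpos ε hS
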